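/- A \emph{Nevanlinna function} is a meromorphic function $f:\mathbf{C}\to\overline{\mathbf{C}}$, with $f'\not\equiv 0$, satisfying $$\frac{f'''}{f'}-\frac32\left(\frac{f''}{f'}\right)^2=2P$$ for some polynomial $P$; it is called \emph{real} if $f(\mathbf{R})\subset\mathbf{R}\cup\{\infty\}$. A point $a\in\overline{\mathbf{C}}$ is an \emph{asymptotic value} of $f$ if $f(\gamma(t))\to a$ as $t\to\infty$ for some curve $\gamma:[0,\infty)\to\mathbf{C}$ with $\gamma(t)\to\infty$. Let $A\subset\overline{\mathbf{C}}$ be a finite set such that $f:\mathbf{C}\setminus f^{-1}(A)\to\overline{\mathbf{C}}\setminus A$ is a covering, and for each $a\in A$ let $D_a\subset\overline{\mathbf{C}}$ be an open topological disc with $D_a\cap A=\{a\}$. A \emph{logarithmic singularity} of $f$ over $a\in A$ is a connected component $V$ of $f^{-1}(D_a\setminus\{a\})$ such that the covering $f:V\to D_a\setminus\{a\}$ has infinite degree; the number of logarithmic singularities does not depend on the choice of $A$ and of the discs $D_a$. \textbf{Statement.} If a real Nevanlinna function has at least three logarithmic singularities and all its asymptotic values lie in $\mathbf{R}\cup\{\infty\}$,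 then it has at most one real zero. -/

import Mathlib

open Filter Topology Set

noncomputable section

namespace NevanlinnaFunctions

/-- The map `ℂ → ℂ ∪ {∞}` defined by a meromorphic function: its value is `∞` at the poles, and at
every other point it is the value of the analytic continuation of `f` to that point (the value
`f z` itself plays no role when `z` is a pole or a removable singularity). -/
def toSphere (f : ℂ → ℂ) (z : ℂ) : OnePoint ℂ :=
  open Classical in
  if meromorphicOrderAt f z < 0 then OnePoint.infty
  else ((toMeromorphicNFAt f z z : ℂ) : OnePoint ℂ)

/-- The extended real line `ℝ ∪ {∞}` inside the Riemann sphere. -/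
def extendedRealLine : Set (OnePoint ℂ) :=
  insert OnePoint.infty (Set.range fun x : ℝ => ((x : ℂ) : OnePoint ℂ))

/-- The Schwarzian derivative `f''' / f' - (3/2) (f'' / f')²`. -/
def schwarzian (f : ℂ → ℂ) (z : ℂ) : ℂ :=
  iteratedDeriv 3 f z / deriv f z - 3 / 2 * (iteratedDeriv 2 f z / deriv f z) ^ 2

/-- A Nevanlinna function: a meromorphic function in the plane, with `f'` not identically zero,
whose Schwarzian derivative is `2 P` for some polynomial `P`. The equation is an identity between
meromorphic functions, that is, it holds outside a closed discrete set. -/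
def IsNevanlinna (f : ℂ → ℂ) : Prop :=
  Meromorphic f ∧ ∃ P : Polynomial ℂ,
    ∀ᶠ z in codiscrete ℂ, deriv f z ≠ 0 ∧ schwarzian f z = 2 * P.eval z

/-- A real meromorphic function: it maps the real line into `ℝ ∪ {∞}`. -/
def IsReal (f : ℂ → ℂ) : Prop :=
  ∀ x : ℝ, toSphere f x ∈ extendedRealLine

/-- `a` is an asymptotic value of `f`: the limit of `f` along some curve tending to `∞`. -/
def IsAsymptoticValue (f : ℂ → ℂ) (a : OnePoint ℂ) : Prop :=
  ∃ γ : ℝ → ℂ, ContinuousOn γ (Ici 0) ∧ Tendsto γ atTop (cocompact ℂ) ∧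
    Tendsto (fun t => toSphere f (γ t)) atTop (𝓝 a)

/-- `A` is a set of base points of `f`: it is finite, and `f` is a covering over its complement. -/
def IsBaseSet (f : ℂ → ℂ) (A : Set (OnePoint ℂ)) : Prop :=
  A.Finite ∧ IsCoveringMapOn (toSphere f) Aᶜ

/-- `D` assigns to each `a ∈ A` an open topological disc whose only point in `A` is `a`. -/
def IsolatingDiscs (A : Set (OnePoint ℂ)) (D : OnePoint ℂ → Set (OnePoint ℂ)) : Prop :=
  ∀ a ∈ A, IsOpen (D a) ∧ Nonempty (D a ≃ₜ Metric.ball (0 : ℂ) 1) ∧ D a ∩ A = {a}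

/-- The logarithmic singularities of `f`, relative to base points `A` and discs `D`: the pairs
`(a, V)` where `a ∈ A` and `V` is a connected component of the preimage of the punctured disc
`D a \ {a}` such that the covering `V → D a \ {a}` has infinite degree. -/
def logSingularities (f : ℂ → ℂ) (A : Set (OnePoint ℂ)) (D : OnePoint ℂ → Set (OnePoint ℂ)) :
    Set (OnePoint ℂ × Set ℂ) :=
  {p | p.1 ∈ A ∧
    (∃ z ∈ toSphere f ⁻¹' (D p.1 \ {p.1}),
      p.2 = connectedComponentIn (toSphere f ⁻¹' (D p.1 \ {p.1})) z) ∧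
    ∀ w ∈ D p.1 \ {p.1}, (p.2 ∩ toSphere f ⁻¹' {w}).Infinite}

/-- `f` has at least `n` logarithmic singularities. Their number does not depend on the choice of
the base points and of the discs. -/
def HasAtLeastLogSingularities (f : ℂ → ℂ) (n : ℕ) : Prop :=
  ∃ (A : Set (OnePoint ℂ)) (D : OnePoint ℂ → Set (OnePoint ℂ)),
    IsBaseSet f A ∧ IsolatingDiscs A D ∧ (n : ℕ∞) ≤ (logSingularities f A D).encard

end NevanlinnaFunctions

end

/-! A holomorphic Schwarzian forces `f` to be locally biholomorphic into the sphere
(`meromorphicOrderAt_deriv_of_schwarzian`, `deriv_ne_zero_or_deriv_inv_ne_zero`). No asymptotic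
value is non-real, so paths in an open half-plane lift; the half-plane being convex, `f` is
injective on each connected set that it sends there (`injOn_of_mapsTo_convex`). Since `f` is real
and locally injective, a thin strip above a compact real interval goes to non-real values, hence
into one half-plane `K`, and `f` is injective on the strip. If two real points had the same finite
image, points of `K` near that image would have preimages in the strip near both. So every finite
value, in particular `0`, is taken at most once on the real line. -/

namespace IsLocalHomeomorph

/-! ### Path lifting through local homeomorphisms -/

variable {E X : Type*} [TopologicalSpace E] [T2Space E] [TopologicalSpace X] {p : E → X}

/-- A partial lift of a path through a local homeomorphism converges to each of its cluster
points. -/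
theorem tendsto_of_mapClusterPt [T2Space X] (hp : IsLocalHomeomorph p) {c : ℝ → X}
    (hc : Continuous c) {b : ℝ} (hb : 0 < b) {δ : ℝ → E} (hδ : ContinuousOn δ (Ico 0 b))
    (hl : ∀ t ∈ Ico 0 b, p (δ t) = c t) {e : E} (he : MapClusterPt e (𝓝[<] b) δ) :
    Tendsto δ (𝓝[<] b) (𝓝 e) := by
  have hIco : Ico 0 b ∈ 𝓝[<] b := Ico_mem_nhdsLT hb
  have hpe : p e = c b := by
    have h1 : MapClusterPt (p e) (𝓝[<] b) (p ∘ δ) := he.continuousAt_comp hp.continuous.continuousAt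
    have h2 : Tendsto (p ∘ δ) (𝓝[<] b) (𝓝 (c b)) :=
      ((hc.tendsto b).mono_left nhdsWithin_le_nhds).congr'
        (by filter_upwards [hIco] with t ht using (hl t ht).symm)
    exact eq_of_nhds_neBot (h1.neBot.mono (inf_le_inf_left _ h2))
  obtain ⟨q, hq, rfl⟩ := hp e
  have hcb : c b ∈ q.target := hpe ▸ q.map_source hq
  have hev : ∀ᶠ t in 𝓝 b, c t ∈ q.target := hc.continuousAt (q.open_target.mem_nhds hcb)
  obtain ⟨ε, hε, hball⟩ := Metric.eventually_nhds_iff.mp hev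
  have hnear : ∀ᶠ t in 𝓝[<] b, t ∈ Ico (max 0 (b - ε)) b ∧ b - ε < t :=
    (Filter.Eventually.and (Ico_mem_nhdsLT (by simp [hb, hε]))
      (Filter.mem_of_superset (Ioo_mem_nhdsLT (by linarith : b - ε < b)) fun t ht => ht.1))
  obtain ⟨t₁, h₁, ht₁, hεt⟩ :=
    ((he.frequently (q.open_source.mem_nhds hq)).and_eventually hnear).exists
  have ht0 : 0 ≤ t₁ := (le_max_left _ _).trans ht₁.1
  have hsub : ∀ t ∈ Ico t₁ b, c t ∈ q.target := fun t ht => hball (by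
    rw [Real.dist_eq, abs_lt]; constructor <;> linarith [ht.1, ht.2])
  have heq : EqOn δ (fun t => q.symm (c t)) (Ico t₁ b) := by
    refine (T2Space.isSeparatedMap q).eqOn_of_comp_eqOn hp.isLocallyInjective
      isPreconnected_Ico (hδ.mono (Ico_subset_Ico_left ht0))
      (q.continuousOn_symm.comp hc.continuousOn hsub) ?_ (left_mem_Ico.2 ht₁.2) ?_
    · intro t ht
      simp [hl t ⟨ht0.trans ht.1, ht.2⟩, q.right_inv (hsub t ht)]
    · simp [← hl t₁ ⟨ht0, ht₁.2⟩, q.left_inv h₁]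
  have hlim : Tendsto (fun t => q.symm (c t)) (𝓝[<] b) (𝓝 e) := by
    have := (q.continuousAt_symm hcb).tendsto.comp (hc.tendsto b)
    rw [← hpe, q.left_inv hq] at this
    exact this.mono_left nhdsWithin_le_nhds
  exact hlim.congr' (by filter_upwards [Ico_mem_nhdsLT ht₁.2] with t ht using (heq ht).symm)

/-- A path lifts through a local homeomorphism as soon as its partial lifts have cluster points. -/
theorem exists_path_lift [T2Space X] (hp : IsLocalHomeomorph p) {c : ℝ → X}
    (hc : Continuous c) {e₀ : E} (h₀ : p e₀ = c 0)
    (hcl : ∀ b ∈ Ioc (0 : ℝ) 1, ∀ δ : ℝ → E, ContinuousOn δ (Ico 0 b) →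
      (∀ t ∈ Ico 0 b, p (δ t) = c t) → ∃ e, MapClusterPt e (𝓝[<] b) δ) :
    ∃ δ : ℝ → E, ContinuousOn δ (Icc 0 1) ∧ (∀ t ∈ Icc (0 : ℝ) 1, p (δ t) = c t) ∧ δ 0 = e₀ := by
  classical
  let IsLift (b : ℝ) (δ : ℝ → E) : Prop :=
    ContinuousOn δ (Icc 0 b) ∧ (∀ t ∈ Icc 0 b, p (δ t) = c t) ∧ δ 0 = e₀
  have mono : ∀ {a b δ}, a ≤ b → IsLift b δ → IsLift a δ := fun hab h =>
    ⟨h.1.mono (Icc_subset_Icc_right hab), fun t ht => h.2.1 t ⟨ht.1, ht.2.trans hab⟩, h.2.2⟩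
  have uniq : ∀ {b δ δ'}, 0 ≤ b → IsLift b δ → IsLift b δ' → EqOn δ δ' (Icc 0 b) :=
    fun hb h h' => (T2Space.isSeparatedMap p).eqOn_of_comp_eqOn hp.isLocallyInjective
      isPreconnected_Icc h.1 h'.1 (fun t ht => (h.2.1 t ht).trans (h'.2.1 t ht).symm)
      (left_mem_Icc.2 hb) (h.2.2.trans h'.2.2.symm)
  -- Continuity method: the supremum is attained because partial lifts have cluster points, and a
  -- local inverse continues the lift past any time below `1`.
  let S : Set ℝ := {b | b ∈ Icc 0 1 ∧ ∃ δ, IsLift b δ}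
  have hS0 : (0 : ℝ) ∈ S := by
    refine ⟨by simp, fun _ => e₀, continuousOn_const, fun t ht => ?_, rfl⟩
    rw [Icc_self, mem_singleton_iff] at ht
    rw [ht, h₀]
  have hSb : BddAbove S := ⟨1, fun b hb => hb.1.2⟩
  set b := sSup S with hbdef
  have hb0 : 0 ≤ b := le_csSup hSb hS0
  have hb1 : b ≤ 1 := csSup_le ⟨0, hS0⟩ fun b hb => hb.1.2
  have hbelow : ∀ t ∈ Ico 0 b, ∃ δ, IsLift t δ := fun t ht => by
    obtain ⟨s, hs, hts⟩ := exists_lt_of_lt_csSup ⟨0, hS0⟩ ht.2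
    exact hs.2.imp fun δ h => mono hts.le h
  have hbS : ∃ δ, IsLift b δ := by
    rcases hb0.eq_or_lt with h | hbpos
    · exact h ▸ hS0.2
    have : Nonempty E := ⟨e₀⟩
    choose! Γ hΓ using hbelow
    let δ : ℝ → E := fun t => Γ t t
    have hδΓ : ∀ s ∈ Ico 0 b, EqOn δ (Γ s) (Icc 0 s) := fun s hs t ht =>
      uniq ht.1 (hΓ t ⟨ht.1, ht.2.trans_lt hs.2⟩) (mono ht.2 (hΓ s hs)) (right_mem_Icc.2 ht.1)
    have hδ : ContinuousOn δ (Ico 0 b) := fun t ht => by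
      have hs : (t + b) / 2 ∈ Ico 0 b := ⟨by linarith [ht.1], by linarith [ht.2]⟩
      have hts : t < (t + b) / 2 := by linarith [ht.2]
      have h1 : ContinuousWithinAt δ (Icc 0 ((t + b) / 2)) t :=
        ((hΓ _ hs).1.congr (hδΓ _ hs)) t ⟨ht.1, hts.le⟩
      refine h1.mono_of_mem_nhdsWithin ?_
      filter_upwards [self_mem_nhdsWithin, mem_nhdsWithin_of_mem_nhds (Iio_mem_nhds hts)]
        with u hu hu' using ⟨hu.1, hu'.le⟩
    have hl : ∀ t ∈ Ico 0 b, p (δ t) = c t := fun t ht => (hΓ t ht).2.1 t (right_mem_Icc.2 ht.1)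
    obtain ⟨e, he⟩ := hcl b ⟨hbpos, hb1⟩ δ hδ hl
    have hlim := hp.tendsto_of_mapClusterPt hc hbpos hδ hl he
    have hpe : p e = c b := by
      have h2 : Tendsto (p ∘ δ) (𝓝[<] b) (𝓝 (c b)) :=
        ((hc.tendsto b).mono_left nhdsWithin_le_nhds).congr'
          (by filter_upwards [Ico_mem_nhdsLT hbpos] with t ht using (hl t ht).symm)
      exact tendsto_nhds_unique ((hp.continuous.tendsto e).comp hlim) h2
    refine ⟨Function.update δ b e, ?_, fun t ht => ?_, ?_⟩
    · rw [continuousOn_update_iff, Icc_sdiff_right]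
      exact ⟨hδ, fun _ => hlim.mono_left (nhdsWithin_mono _ fun t ht => ht.2)⟩
    · rcases ht.2.eq_or_lt with rfl | htb
      · simpa using hpe
      · simpa [Function.update_of_ne htb.ne] using hl t ⟨ht.1, htb⟩
    · rw [Function.update_of_ne hbpos.ne]
      exact (hΓ 0 ⟨le_rfl, hbpos⟩).2.2
  rcases hb1.eq_or_lt with h1 | hlt
  · obtain ⟨δ, hδ⟩ := hbS
    rw [h1] at hδ
    exact ⟨δ, hδ⟩
  exfalso
  obtain ⟨δ, hδ⟩ := hbS
  obtain ⟨q, hq, hqp⟩ := hp (δ b)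
  have hcb : c b = q (δ b) := by rw [← hqp]; exact (hδ.2.1 b (right_mem_Icc.2 hb0)).symm
  have hev : ∀ᶠ t in 𝓝 b, c t ∈ q.target :=
    hc.continuousAt (q.open_target.mem_nhds (hcb ▸ q.map_source hq))
  obtain ⟨ε, hε, hball⟩ := Metric.eventually_nhds_iff.mp hev
  set b' := min 1 (b + ε / 2) with hb'
  have hbb' : b < b' := lt_min hlt (by linarith)
  have hb'ε : b' ≤ b + ε / 2 := min_le_right _ _
  have hsub : ∀ t ∈ Icc b b', c t ∈ q.target := fun t ht => hball (by
    rw [Real.dist_eq, abs_lt]; constructor <;> linarith [ht.1, ht.2])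
  let δ' : ℝ → E := fun t => if t ≤ b then δ t else q.symm (c t)
  have e1 : EqOn δ' δ (Icc 0 b) := fun t ht => if_pos ht.2
  have e2 : EqOn δ' (fun t => q.symm (c t)) (Icc b b') := fun t ht => by
    rcases ht.1.eq_or_lt with rfl | h
    · simp [δ', hcb, q.left_inv hq]
    · simp [δ', h.not_ge]
  have hlift : IsLift b' δ' := by
    refine ⟨?_, fun t ht => ?_, ?_⟩
    · rw [← Icc_union_Icc_eq_Icc hb0 hbb'.le]
      exact (hδ.1.congr e1).union_of_isClosed
        ((q.continuousOn_symm.comp hc.continuousOn hsub).congr e2) isClosed_Icc isClosed_Icc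
    · rcases le_total t b with h | h
      · rw [e1 ⟨ht.1, h⟩, hδ.2.1 t ⟨ht.1, h⟩]
      · rw [e2 ⟨h, ht.2⟩, hqp, q.right_inv (hsub t ⟨h, ht.2⟩)]
    · rw [e1 (left_mem_Icc.2 hb0), hδ.2.2]
  have : b' ≤ b := le_csSup hSb ⟨⟨hb0.trans hbb'.le, min_le_left _ _⟩, δ', hlift⟩
  exact this.not_gt hbb'

/-- A local homeomorphism into a convex set, in which partial lifts of paths have cluster points,
is injective on preconnected sets. -/
theorem injOn_of_convex {X : Type*} [AddCommGroup X] [Module ℝ X] [TopologicalSpace X]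
    [IsTopologicalAddGroup X] [ContinuousSMul ℝ X] [T2Space X] {p : E → X}
    (hp : IsLocalHomeomorph p) {K : Set X} (hK : Convex ℝ K) (hpK : ∀ e, p e ∈ K)
    (hcl : ∀ c : ℝ → X, Continuous c → (∀ t ∈ Icc (0 : ℝ) 1, c t ∈ K) → ∀ b ∈ Ioc (0 : ℝ) 1,
      ∀ δ : ℝ → E, ContinuousOn δ (Ico 0 b) → (∀ t ∈ Ico 0 b, p (δ t) = c t) →
      ∃ e, MapClusterPt e (𝓝[<] b) δ)
    {V : Set E} (hV : IsPreconnected V) : InjOn p V := by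
  intro e he e' he' hee
  have sep := T2Space.isSeparatedMap p
  have lift : ∀ w : K, ∃ δ : ℝ → E, ContinuousOn δ (Icc 0 1) ∧
      (∀ t ∈ Icc (0 : ℝ) 1, p (δ t) = AffineMap.lineMap (p e) (w : X) t) ∧ δ 0 = e := fun w =>
    hp.exists_path_lift AffineMap.lineMap_continuous (by simp) fun b hb δ hδ hl =>
      hcl _ AffineMap.lineMap_continuous
        (fun t ht => hK.lineMap_mem (hpK e) w.2 ht) b hb δ hδ hl
  choose γ hγc hγl hγ0 using lift
  let F : C(unitInterval × K, X) :=
    ⟨fun a => AffineMap.lineMap (p e) (a.2 : X) (a.1 : ℝ), by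
      simp only [AffineMap.lineMap_apply_module]; fun_prop⟩
  let g : unitInterval × K → E := fun a => γ a.2 a.1
  have hg : Continuous g := by
    refine hp.continuous_lift sep F (funext fun a => hγl a.2 a.1 a.1.2) ?_ fun w => ?_
    · simpa [g, hγ0] using continuous_const
    · exact (hγc w).comp_continuous continuous_subtype_val fun t => t.2
  -- `r` sends `z` to the endpoint of the lift, starting at `e`, of the segment from `p e` to `p z`.
  -- On `V`, `r` and the identity both lift `p` and agree at `e`, so they coincide; but `r z`
  -- depends only on `p z`.
  let r : E → E := fun z => g (1, ⟨p z, hpK z⟩)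
  have hr : Continuous r := hg.comp (continuous_const.prodMk (hp.continuous.subtype_mk _))
  have hpr : p ∘ r = p := funext fun z => by simp [r, g, hγl]
  have hre : r e = e := by
    have := sep.eqOn_of_comp_eqOn hp.isLocallyInjective (isPreconnected_Icc (a := (0 : ℝ)) (b := 1))
      (hγc ⟨p e, hpK e⟩) (continuousOn_const (c := e)) (fun t ht => by simp [hγl _ t ht])
      (left_mem_Icc.2 zero_le_one) (hγ0 _)
    exact this (right_mem_Icc.2 zero_le_one)
  have h2 : r e' = e' := sep.eqOn_of_comp_eqOn hp.isLocallyInjective hV hr.continuousOn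
    continuousOn_id (fun z _ => congrFun hpr z) he hre he'
  have h3 : r e' = r e := by simp only [r, hee]
  rw [← hre, ← h3, h2]

end IsLocalHomeomorph

/-! ### Local injectivity from the Schwarzian equation -/

namespace NevanlinnaFunctions

/-- If the Schwarzian derivative extends continuously to `z₀`, then `f'` has order `0` or `-2`
there. -/
theorem meromorphicOrderAt_deriv_of_schwarzian {f h : ℂ → ℂ} {z₀ : ℂ} (hf : MeromorphicAt f z₀)
    (hh : ContinuousAt h z₀)
    (hS : ∀ᶠ z in 𝓝[≠] z₀, deriv f z ≠ 0 ∧ schwarzian f z = h z) :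
    meromorphicOrderAt (deriv f) z₀ = 0 ∨ meromorphicOrderAt (deriv f) z₀ = (-2 : ℤ) := by
  have hg : MeromorphicAt (deriv f) z₀ := hf.deriv
  obtain ⟨m, hm⟩ := WithTop.ne_top_iff_exists.mp
    ((meromorphicOrderAt_ne_top_iff_eventually_ne_zero hg).2 (hS.mono fun z hz => hz.1))
  obtain ⟨u, hu, hu0, hgu⟩ := (meromorphicOrderAt_eq_int_iff hg).1 hm.symm
  have hgu' : deriv f =ᶠ[𝓝[≠] z₀] fun z => (z - z₀) ^ m * u z := hgu
  have hL : AnalyticAt ℂ (logDeriv u) z₀ := hu.deriv.div hu hu0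
  -- `q` is `f'' / f'` for `f' = (z - z₀) ^ m * u`; the Schwarzian is then `q' - q² / 2`.
  let q : ℂ → ℂ := fun z => m / (z - z₀) + logDeriv u z
  have hune : ∀ᶠ z in 𝓝[≠] z₀, u z ≠ 0 :=
    (hu.continuousAt.eventually_ne hu0).filter_mono nhdsWithin_le_nhds
  have huan : ∀ᶠ z in 𝓝[≠] z₀, AnalyticAt ℂ u z :=
    hu.eventually_analyticAt.filter_mono nhdsWithin_le_nhds
  have hLan : ∀ᶠ z in 𝓝[≠] z₀, AnalyticAt ℂ (logDeriv u) z :=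
    hL.eventually_analyticAt.filter_mono nhdsWithin_le_nhds
  have hne : ∀ᶠ z in 𝓝[≠] z₀, z ≠ z₀ := self_mem_nhdsWithin
  have hd1 : deriv (deriv f) =ᶠ[𝓝[≠] z₀] fun z => deriv f z * q z := by
    filter_upwards [hgu'.nhdsNE_deriv, hgu', hune, huan, hne] with z h1 h2 h3 h4 h5
    have h5' : z - z₀ ≠ 0 := sub_ne_zero.2 h5
    have hd : HasDerivAt (fun z => (z - z₀) ^ m) (m * (z - z₀) ^ (m - 1)) z :=
      (hasDerivAt_zpow m (z - z₀) (Or.inl h5')).comp_sub_const z z₀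
    rw [h1, (hd.fun_mul h4.differentiableAt.hasDerivAt).deriv, h2]
    simp only [q, logDeriv_apply, zpow_sub_one₀ h5']
    field_simp
  have hd2 : deriv (deriv (deriv f)) =ᶠ[𝓝[≠] z₀]
      fun z => deriv f z * (q z ^ 2 + (-m / (z - z₀) ^ 2 + deriv (logDeriv u) z)) := by
    have hfan : ∀ᶠ z in 𝓝[≠] z₀, AnalyticAt ℂ (deriv f) z := hg.eventually_analyticAt
    filter_upwards [hd1.nhdsNE_deriv, hd1, hfan, hLan, hne] with z h1 h2 h3 h4 h5
    have h5' : z - z₀ ≠ 0 := sub_ne_zero.2 h5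
    have hq : HasDerivAt q (-m / (z - z₀) ^ 2 + deriv (logDeriv u) z) z := by
      have := ((hasDerivAt_const z (m : ℂ)).fun_div ((hasDerivAt_id z).sub_const z₀) h5').fun_add
        h4.differentiableAt.hasDerivAt
      simpa [q] using this
    rw [h1, (h3.differentiableAt.hasDerivAt.fun_mul hq).deriv, h2]
    ring
  -- Multiplying the Schwarzian by `(z - z₀)²` and letting `z → z₀` leaves `-m - m² / 2 = 0`.
  have hev : (fun z => -(m : ℂ) + (z - z₀) ^ 2 * deriv (logDeriv u) z
      - (m + (z - z₀) * logDeriv u z) ^ 2 / 2) =ᶠ[𝓝[≠] z₀] fun z => (z - z₀) ^ 2 * h z := by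
    filter_upwards [hS, hd1, hd2, hne] with z h1 h2 h3 h5
    have h5' : z - z₀ ≠ 0 := sub_ne_zero.2 h5
    have h0 := h1.1
    rw [← h1.2, schwarzian, iteratedDeriv_succ, iteratedDeriv_succ, iteratedDeriv_one, h3, h2]
    simp only [q]
    field_simp
    ring
  have hc1 : ContinuousAt (fun z => -(m : ℂ) + (z - z₀) ^ 2 * deriv (logDeriv u) z
      - (m + (z - z₀) * logDeriv u z) ^ 2 / 2) z₀ := by
    have := hL.continuousAt
    have := hL.deriv.continuousAt
    fun_prop
  have hc2 : ContinuousAt (fun z => (z - z₀) ^ 2 * h z) z₀ := by fun_prop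
  have key := tendsto_nhds_unique ((hc1.tendsto.mono_left nhdsWithin_le_nhds).congr' hev)
    (hc2.tendsto.mono_left nhdsWithin_le_nhds)
  have key' : (m : ℂ) * (m + 2) = 0 := by
    simp only [sub_self] at key
    linear_combination -2 * key
  have : m = 0 ∨ m = -2 := by
    have : m * (m + 2) = 0 := by exact_mod_cast key'
    rcases mul_eq_zero.1 this with h | h <;> omega
  rw [← hm]
  rcases this with rfl | rfl
  · exact Or.inl rfl
  · exact Or.inr rfl

/-- A meromorphic function is locally biholomorphic into the Riemann sphere where the order of its
derivative is `0` or `-2`. -/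
theorem deriv_ne_zero_or_deriv_inv_ne_zero {g : ℂ → ℂ} {z₀ : ℂ} (hg : MeromorphicNFAt g z₀)
    (ho : meromorphicOrderAt (deriv g) z₀ = 0 ∨ meromorphicOrderAt (deriv g) z₀ = (-2 : ℤ)) :
    (AnalyticAt ℂ g z₀ ∧ deriv g z₀ ≠ 0) ∨
      (meromorphicOrderAt g z₀ < 0 ∧ AnalyticAt ℂ g⁻¹ z₀ ∧ deriv g⁻¹ z₀ ≠ 0) := by
  have deriv_ne : ∀ {g : ℂ → ℂ}, AnalyticAt ℂ g z₀ → meromorphicOrderAt (deriv g) z₀ = 0 →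
      deriv g z₀ ≠ 0 := fun {g} hg h => by
    exact (hg.deriv.meromorphicNFAt.meromorphicOrderAt_eq_zero_iff).1 h
  by_cases hneg : meromorphicOrderAt g z₀ < 0
  · obtain ⟨n, hn⟩ := WithTop.ne_top_iff_exists.mp hneg.ne_top
    rw [← hn] at hneg
    have hn0 : n < 0 := by exact_mod_cast hneg
    have hd := meromorphicOrderAt_deriv_eq_sub_one (𝕜 := ℂ) (n := n) (f := g) (x := z₀)
      (by exact_mod_cast hn0.ne) hn.symm
    -- The derivative has order `n - 1 < 0`, which must be `-2`: every pole is simple.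
    have hn1 : n = -1 := by
      rw [hd] at ho
      rcases ho with h | h
      · have : n - 1 = 0 := by exact_mod_cast h
        omega
      · have : n - 1 = -2 := by exact_mod_cast h
        omega
    have hinv : meromorphicOrderAt g⁻¹ z₀ = (1 : ℤ) := by
      rw [meromorphicOrderAt_inv, ← hn, hn1]; rfl
    have han : AnalyticAt ℂ g⁻¹ z₀ :=
      (hg.inv.meromorphicOrderAt_nonneg_iff_analyticAt).1 (by rw [hinv]; exact_mod_cast zero_le_one)
    refine Or.inr ⟨hn ▸ hneg, han, deriv_ne han ?_⟩
    rw [meromorphicOrderAt_deriv_eq_sub_one (by simp) hinv]; simp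
  · have han := (hg.meromorphicOrderAt_nonneg_iff_analyticAt).1 (not_lt.1 hneg)
    refine Or.inl ⟨han, deriv_ne han (ho.resolve_right fun h => ?_)⟩
    have := han.deriv.meromorphicOrderAt_nonneg
    rw [h] at this
    exact absurd (by exact_mod_cast this : (0 : ℤ) ≤ -2) (by norm_num)

/-! ### Reflection symmetry at the real line -/

/-- Near a real point, a locally injective analytic function which is real on the real line is
compatible with complex conjugation. -/
theorem eventually_conj_of_real {h : ℂ → ℂ} {x : ℝ} (hh : AnalyticAt ℂ h x)
    (hr : ∀ᶠ t : ℝ in 𝓝[≠] x, (h t).im = 0) :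
    ∀ᶠ z in 𝓝 (x : ℂ), h (starRingEnd ℂ z) = starRingEnd ℂ (h z) := by
  let k : ℂ → ℂ := fun z => starRingEnd ℂ (h (starRingEnd ℂ z))
  have hconj : Tendsto (starRingEnd ℂ) (𝓝 (x : ℂ)) (𝓝 (x : ℂ)) := by
    simpa using (Complex.continuous_conj.tendsto (x : ℂ))
  have hk : AnalyticAt ℂ k x := by
    refine Complex.analyticAt_iff_eventually_differentiableAt.2 ?_
    filter_upwards [hconj.eventually hh.eventually_analyticAt] with z hz
    have := hz.differentiableAt.conj_conj
    rwa [Complex.conj_conj] at this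
  have hfreq : ∃ᶠ z in 𝓝[≠] (x : ℂ), k z = h z := by
    have ht : Tendsto (fun t : ℝ => (t : ℂ)) (𝓝[≠] x) (𝓝[≠] (x : ℂ)) :=
      tendsto_nhdsWithin_of_tendsto_nhds_of_eventually_within _
        ((Complex.continuous_ofReal.tendsto x).mono_left nhdsWithin_le_nhds)
        (by filter_upwards [self_mem_nhdsWithin] with t ht using by simpa using ht)
    refine ht.frequently (hr.mono fun t ht => ?_).frequently
    simpa [k] using Complex.conj_eq_iff_im.2 ht
  filter_upwards [(hk.frequently_eq_iff_eventually_eq hh).1 hfreq] with z hz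
  rw [← hz]; simp [k]

/-- By reflection, a real value at `z` is also taken at the conjugate of `z`; local injectivity
makes the two points equal. -/
theorem eventually_im_eq_zero_of_real {h : ℂ → ℂ} {x : ℝ} (hh : AnalyticAt ℂ h x)
    (hd : deriv h x ≠ 0) (hr : ∀ᶠ t : ℝ in 𝓝[≠] x, (h t).im = 0) :
    ∀ᶠ z in 𝓝 (x : ℂ), (h z).im = 0 → z.im = 0 := by
  have hst : HasStrictDerivAt h (deriv h x) (x : ℂ) := hh.hasStrictDerivAt
  set q := (hst.hasStrictFDerivAt_equiv hd).toOpenPartialHomeomorph h with hq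
  have hqx : q.source ∈ 𝓝 (x : ℂ) := q.open_source.mem_nhds
    (hst.hasStrictFDerivAt_equiv hd).mem_toOpenPartialHomeomorph_source
  have hconj : Tendsto (starRingEnd ℂ) (𝓝 (x : ℂ)) (𝓝 (x : ℂ)) := by
    simpa using (Complex.continuous_conj.tendsto (x : ℂ))
  filter_upwards [hqx, hconj hqx, eventually_conj_of_real hh hr] with z h1 h2 h3 h4
  rw [Complex.conj_eq_iff_im.2 h4] at h3
  exact Complex.conj_eq_iff_im.1 (q.injOn h2 h1 h3)

theorem eventually_im_eq_zero_of_real_of_meromorphic {g : ℂ → ℂ} {x : ℝ}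
    (hg : (AnalyticAt ℂ g x ∧ deriv g x ≠ 0) ∨
      (meromorphicOrderAt g x < 0 ∧ AnalyticAt ℂ g⁻¹ x ∧ deriv g⁻¹ x ≠ 0))
    (hr : ∀ᶠ t : ℝ in 𝓝[≠] x, (g t).im = 0) :
    ∀ᶠ z in 𝓝 (x : ℂ), (g z).im = 0 → z.im = 0 := by
  rcases hg with h | ⟨-, h, hd⟩
  · exact eventually_im_eq_zero_of_real h.1 h.2 hr
  · filter_upwards [eventually_im_eq_zero_of_real h hd
      (hr.mono fun t ht => by simp [Complex.inv_im, ht])] with z hz h0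
    exact hz (by simp [Complex.inv_im, h0])

/-! ### Lifting over regions without asymptotic values -/

/-- A partial lift without cluster points would escape to infinity, making `c b` an asymptotic
value. A cluster point cannot be a pole, since `g ∘ γ` stays bounded near time `b`. -/
theorem exists_mapClusterPt_of_no_asymptotic {g : ℂ → ℂ} (hg : MeromorphicNFOn g univ)
    {c : ℝ → ℂ} (hc : Continuous c) {b : ℝ} (hb : 0 < b)
    (has : ∀ γ : ℝ → ℂ, ContinuousOn γ (Ici 0) → Tendsto γ atTop (cocompact ℂ) →
      (∀ t ∈ Ici (0 : ℝ), AnalyticAt ℂ g (γ t)) → ¬ Tendsto (g ∘ γ) atTop (𝓝 (c b)))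
    {γ : ℝ → ℂ} (hγ : ContinuousOn γ (Ico 0 b)) (han : ∀ t ∈ Ico 0 b, AnalyticAt ℂ g (γ t))
    (hl : ∀ t ∈ Ico 0 b, g (γ t) = c t) :
    ∃ z, AnalyticAt ℂ g z ∧ g z = c b ∧ MapClusterPt z (𝓝[<] b) γ := by
  have hIco : Ico 0 b ∈ 𝓝[<] b := Ico_mem_nhdsLT hb
  have hlim : Tendsto (g ∘ γ) (𝓝[<] b) (𝓝 (c b)) :=
    ((hc.tendsto b).mono_left nhdsWithin_le_nhds).congr'
      (by filter_upwards [hIco] with t ht using (hl t ht).symm)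
  have hnot : ¬ Tendsto γ (𝓝[<] b) (cocompact ℂ) := fun hγc => by
    -- Reparametrises `[0, b)` by `[0, ∞)`, as the definition of an asymptotic curve requires.
    let φ : ℝ → ℝ := fun t => b - b / (1 + t)
    have hφ : MapsTo φ (Ici 0) (Ico 0 b) := fun t (ht : 0 ≤ t) => by
      have h1 : 0 < b / (1 + t) := by positivity
      have h2 : b / (1 + t) ≤ b := div_le_self hb.le (by linarith)
      constructor <;> simp only [φ] <;> linarith
    have hφc : ContinuousOn φ (Ici 0) := fun t (ht : 0 ≤ t) => by
      have : 1 + t ≠ 0 := by positivity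
      exact (by fun_prop (disch := assumption) : ContinuousAt φ t).continuousWithinAt
    have hφt : Tendsto φ atTop (𝓝[<] b) := by
      refine tendsto_nhdsWithin_of_tendsto_nhds_of_eventually_within _ ?_ ?_
      · have : Tendsto (fun t : ℝ => b / (1 + t)) atTop (𝓝 0) :=
          tendsto_const_nhds.div_atTop (tendsto_atTop_add_const_left _ _ tendsto_id)
        simpa [φ] using tendsto_const_nhds.sub this
      · filter_upwards [eventually_ge_atTop 0] with t ht using (hφ ht).2
    exact has (γ ∘ φ) (hγ.comp hφc hφ) (hγc.comp hφt) (fun t ht => han _ (hφ ht)) (hlim.comp hφt)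
  obtain ⟨s, hs, hfs⟩ : ∃ s, IsCompact s ∧ ∃ᶠ t in 𝓝[<] b, γ t ∈ s := by
    by_contra! h
    refine hnot ((hasBasis_cocompact).tendsto_right_iff.2 fun s hs => ?_)
    simpa using h s hs
  obtain ⟨z, -, hz⟩ := hs.exists_mapClusterPt_of_frequently hfs
  have hzan : AnalyticAt ℂ g z := by
    refine ((hg (mem_univ z)).meromorphicOrderAt_nonneg_iff_analyticAt).1 (not_lt.1 fun hneg => ?_)
    have h1 : ∀ᶠ w in 𝓝[≠] z, ‖c b‖ + 1 ≤ ‖g w‖ :=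
      (tendsto_norm_cobounded_atTop.comp (tendsto_cobounded_of_meromorphicOrderAt_neg hneg)).eventually
        (eventually_ge_atTop _)
    have h2 : ∀ᶠ t in 𝓝[<] b, ‖g (γ t)‖ < ‖c b‖ + 1 := hlim.norm.eventually_lt_const (by simp)
    obtain ⟨t, ht1, ht2, ht3⟩ := ((hz.frequently (eventually_nhdsWithin_iff.1 h1)).and_eventually
      (h2.and hIco)).exists
    refine ht2.not_ge (ht1 ?_)
    rintro (rfl : γ t = z)
    exact hneg.not_ge (han t ht3).meromorphicOrderAt_nonneg
  refine ⟨z, hzan, ?_, hz⟩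
  exact eq_of_nhds_neBot ((hz.continuousAt_comp hzan.continuousAt).neBot.mono
    (inf_le_inf_left _ hlim))

/-- A meromorphic function without critical points is injective on preconnected subsets of the
preimage of a convex open set containing no asymptotic values. -/
theorem injOn_of_mapsTo_convex {g : ℂ → ℂ} (hg : MeromorphicNFOn g univ)
    (hd : ∀ z, AnalyticAt ℂ g z → deriv g z ≠ 0) {K : Set ℂ} (hK : Convex ℝ K) (hKo : IsOpen K)
    (has : ∀ w ∈ K, ∀ γ : ℝ → ℂ, ContinuousOn γ (Ici 0) → Tendsto γ atTop (cocompact ℂ) →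
      (∀ t ∈ Ici (0 : ℝ), AnalyticAt ℂ g (γ t)) → ¬ Tendsto (g ∘ γ) atTop (𝓝 w))
    {V : Set ℂ} (hV : IsPreconnected V) (hVg : ∀ z ∈ V, AnalyticAt ℂ g z ∧ g z ∈ K) :
    InjOn g V := by
  let U : Set ℂ := {z | AnalyticAt ℂ g z ∧ g z ∈ K}
  have hU : IsOpen U := isOpen_iff_mem_nhds.2 fun z hz =>
    hz.1.eventually_analyticAt.and (hz.1.continuousAt (hKo.mem_nhds hz.2))
  let p : U → ℂ := fun z => g z
  have hgU : IsLocalHomeomorphOn g U := fun z hz => by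
    have h := hz.1.hasStrictDerivAt.hasStrictFDerivAt_equiv (hd z hz.1)
    exact ⟨h.toOpenPartialHomeomorph g, h.mem_toOpenPartialHomeomorph_source, rfl⟩
  have hp : IsLocalHomeomorph p := by
    rw [isLocalHomeomorph_iff_isLocalHomeomorphOn_univ]
    exact hgU.comp (isLocalHomeomorph_iff_isLocalHomeomorphOn_univ.1
      hU.isOpenEmbedding_subtypeVal.isLocalHomeomorph) fun z _ => z.2
  have hVU : ((↑) : U → ℂ) '' ((↑) ⁻¹' V) = V := by
    rw [Subtype.image_preimage_coe]
    exact inter_eq_right.2 hVg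
  have hV' : IsPreconnected (((↑) : U → ℂ) ⁻¹' V) := by
    rw [← IsInducing.subtypeVal.isPreconnected_image, hVU]
    exact hV
  have hinj := hp.injOn_of_convex hK (fun e => e.2.2) (fun c hc hcK b hb δ hδ hl => by
    obtain ⟨z, hz, hzc, hcl⟩ := exists_mapClusterPt_of_no_asymptotic hg hc hb.1
      (has (c b) (hcK b ⟨hb.1.le, hb.2⟩)) (γ := fun t => (δ t : ℂ))
      (continuous_subtype_val.comp_continuousOn hδ) (fun t _ => (δ t).2.1) hl
    refine ⟨⟨z, hz, hzc ▸ hcK b ⟨hb.1.le, hb.2⟩⟩, ?_⟩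
    rw [mapClusterPt_iff_frequently] at hcl ⊢
    intro s hs
    obtain ⟨t, ht, hts⟩ := mem_nhds_subtype _ _ _ |>.1 hs
    exact (hcl t ht).mono fun u hu => hts hu) hV'
  intro z hz w hw hzw
  exact congrArg Subtype.val
    (@hinj (⟨z, hVg z hz⟩ : U) hz (⟨w, hVg w hw⟩ : U) hw hzw)

/-! ### Injectivity on the real line -/

/-- A meromorphic function, real on the real line and without critical points, with no asymptotic
values outside the extended real line, takes each finite value at most once on the real line. -/
theorem real_injective_of_real_asymptotic {g : ℂ → ℂ} (hg : MeromorphicNFOn g univ)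
    (hloc : ∀ z, (AnalyticAt ℂ g z ∧ deriv g z ≠ 0) ∨
      (meromorphicOrderAt g z < 0 ∧ AnalyticAt ℂ g⁻¹ z ∧ deriv g⁻¹ z ≠ 0))
    (hr : ∀ x : ℝ, (g x).im = 0)
    (has : ∀ w : ℂ, w.im ≠ 0 → ∀ γ : ℝ → ℂ, ContinuousOn γ (Ici 0) →
      Tendsto γ atTop (cocompact ℂ) → (∀ t ∈ Ici (0 : ℝ), AnalyticAt ℂ g (γ t)) →
      ¬ Tendsto (g ∘ γ) atTop (𝓝 w))
    {x y : ℝ} (hx : AnalyticAt ℂ g x) (hy : AnalyticAt ℂ g y) (hxy : g x = g y) : x = y := by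
  have hd : ∀ z, AnalyticAt ℂ g z → deriv g z ≠ 0 := fun z hz =>
    ((hloc z).resolve_right fun h => h.1.not_ge hz.meromorphicOrderAt_nonneg).2
  -- In normal form a pole carries the value `0`, which is real.
  have han : ∀ z, (g z).im ≠ 0 → AnalyticAt ℂ g z := fun z hz =>
    (meromorphicNFAt_iff_analyticAt_or.1 (hg (mem_univ z))).resolve_right
      fun ⟨_, _, h0⟩ => hz (by simp [h0])
  by_contra hne
  set a := min x y - 1 with ha
  set b := max x y + 1 with hb
  -- Near each point of the interval only real points have real images; compactness gives a uniform
  -- height.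
  obtain ⟨ε, hε, hstrip⟩ : ∃ ε > 0, ∀ z : ℂ, z.re ∈ Icc a b → 0 < z.im → z.im < ε →
      (g z).im ≠ 0 := by
    have h1 : ∀ u ∈ Icc a b, ∀ᶠ q : ℝ × ℝ in 𝓝 ((0 : ℝ), u),
        (g (q.2 + q.1 * Complex.I)).im = 0 → q.1 = 0 := fun u _ => by
      have ht : Tendsto (fun q : ℝ × ℝ => (q.2 + q.1 * Complex.I : ℂ)) (𝓝 ((0 : ℝ), u))
          (𝓝 (u : ℂ)) := by
        have : Continuous fun q : ℝ × ℝ => (q.2 + q.1 * Complex.I : ℂ) := by fun_prop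
        simpa using this.tendsto ((0 : ℝ), u)
      filter_upwards [ht.eventually (eventually_im_eq_zero_of_real_of_meromorphic (hloc u)
        (Eventually.of_forall hr))] with q hq
      simpa using hq
    have h2 := (isCompact_Icc (a := a) (b := b)).eventually_forall_of_forall_eventually
      (P := fun v u : ℝ => (g (u + v * Complex.I)).im = 0 → v = 0) h1
    obtain ⟨ε, hε, h3⟩ := Metric.eventually_nhds_iff.1 h2
    refine ⟨ε, hε, fun z hre hpos hlt h0 => hpos.ne' ?_⟩
    exact h3 (by rwa [Real.dist_eq, sub_zero, abs_of_pos hpos]) z.re hre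
      (by rwa [Complex.re_add_im])
  let S : Set ℂ := {z | z.re ∈ Icc a b ∧ 0 < z.im ∧ z.im < ε}
  have hSc : Convex ℝ S := by
    have : S = Complex.re ⁻¹' Icc a b ∩ Complex.im ⁻¹' Ioo 0 ε := rfl
    rw [this]
    exact ((convex_Icc a b).is_linear_preimage Complex.reCLM.isLinear).inter
      ((convex_Ioo 0 ε).is_linear_preimage Complex.imCLM.isLinear)
  have hSim : ∀ z ∈ S, (g z).im ≠ 0 := fun z hz => hstrip z hz.1 hz.2.1 hz.2.2
  obtain ⟨σ, hσ0, hσ⟩ : ∃ σ : ℝ, σ ≠ 0 ∧ ∀ z ∈ S, 0 < σ * (g z).im := by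
    have hcont : ContinuousOn (fun z => (g z).im) S := fun z hz =>
      (Complex.continuous_im.continuousAt.comp (han z (hSim z hz)).continuousAt).continuousWithinAt
    by_cases h : ∀ z ∈ S, 0 < (g z).im
    · exact ⟨1, one_ne_zero, by simpa using h⟩
    · push Not at h
      obtain ⟨z, hz, hz0⟩ := h
      refine ⟨-1, by norm_num, fun w hw => ?_⟩
      by_contra! hw0
      obtain ⟨v, hv, hv0⟩ := hSc.isPreconnected.intermediate_value hz hw hcont
        (show (0 : ℝ) ∈ Icc _ _ from ⟨hz0, by linarith⟩)
      exact hSim v hv hv0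
  let K : Set ℂ := {w | 0 < σ * w.im}
  have hK : Convex ℝ K := by
    have : K = (σ • Complex.imCLM) ⁻¹' Ioi 0 := rfl
    rw [this]
    exact (convex_Ioi 0).is_linear_preimage (σ • Complex.imCLM).isLinear
  have hKo : IsOpen K := isOpen_lt continuous_const (by fun_prop)
  have hKim : ∀ w ∈ K, w.im ≠ 0 := fun w hw h => by simp [K, h] at hw
  have hinj : InjOn g S := injOn_of_mapsTo_convex hg hd hK hKo (fun w hw => has w (hKim w hw))
    hSc.isPreconnected fun z hz => ⟨han z (hSim z hz), hσ z hz⟩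
  -- `g` is open at `u`, so values near `g u` have preimages near `u`. Those of values in `K` lie
  -- above the axis: real points have real images, and points below it map to the conjugate
  -- half-plane.
  have key : ∀ u : ℝ, u ∈ Ioo a b → AnalyticAt ℂ g u → ∀ N ∈ 𝓝 (u : ℂ),
      ∀ᶠ w in 𝓝 (g u), w ∈ K → ∃ z ∈ N, z ∈ S ∧ g z = w := by
    intro u hu hgu N hN
    have hconj : Tendsto (starRingEnd ℂ) (𝓝 (u : ℂ)) (𝓝 (u : ℂ)) := by
      simpa using (Complex.continuous_conj.tendsto (u : ℂ))
    have hS : ∀ᶠ z in 𝓝 (u : ℂ), 0 < z.im → z ∈ S := by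
      have h1 : ∀ᶠ z in 𝓝 (u : ℂ), z.re ∈ Ioo a b :=
        Complex.continuous_re.continuousAt (Ioo_mem_nhds hu.1 hu.2)
      have h2 : ∀ᶠ z in 𝓝 (u : ℂ), z.im < ε :=
        Complex.continuous_im.continuousAt (Iio_mem_nhds (by simpa using hε))
      filter_upwards [h1, h2] with z h1 h2 h3 using ⟨Ioo_subset_Icc_self h1, h3, h2⟩
    rw [← hgu.hasStrictDerivAt.map_nhds_eq (hd u hgu), eventually_map]
    filter_upwards [hN, hS, hconj.eventually hS,
      eventually_conj_of_real hgu (Eventually.of_forall hr)] with z h1 h2 h3 h4 hzK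
    rcases lt_trichotomy z.im 0 with h | h | h
    · exfalso
      have h5 := hσ _ (h3 (by simpa using h))
      rw [h4, Complex.conj_im] at h5
      have h6 : 0 < σ * (g z).im := hzK
      linarith
    · exfalso
      refine hKim _ hzK ?_
      have : z = (z.re : ℂ) := Complex.ext (by simp) (by simp [h])
      rw [this]
      exact hr z.re
    · exact ⟨z, h1, h2 h, rfl⟩
  -- `g x` is real, hence on the boundary of `K`.
  have hfreq : ∃ᶠ w in 𝓝 (g x), w ∈ K := by
    have ht : Tendsto (fun t : ℝ => g x + (t * σ : ℝ) * Complex.I) (𝓝[>] 0) (𝓝 (g x)) := by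
      have : Continuous fun t : ℝ => g x + (t * σ : ℝ) * Complex.I := by fun_prop
      simpa using (this.tendsto 0).mono_left (nhdsWithin_le_nhds (s := Ioi 0))
    refine ht.frequently (Eventually.frequently ?_)
    filter_upwards [self_mem_nhdsWithin] with t ht
    have h1 : 0 < t * (σ * σ) := mul_pos ht (mul_self_pos.2 hσ0)
    have h2 : (g x + (t * σ : ℝ) * Complex.I).im = t * σ := by
      simp [Complex.add_im, hr]
    simp only [K, mem_ofPred_eq, h2]
    linarith
  obtain ⟨N₁, N₂, hN₁, hN₂, hdisj⟩ := t2_separation_nhds (x := (x : ℂ)) (y := (y : ℂ))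
    (by exact_mod_cast hne)
  have hxab : x ∈ Ioo a b := ⟨by linarith [min_le_left x y], by linarith [le_max_left x y]⟩
  have hyab : y ∈ Ioo a b := ⟨by linarith [min_le_right x y], by linarith [le_max_right x y]⟩
  obtain ⟨w, hwK, h1, h2⟩ := (hfreq.and_eventually
    ((key x hxab hx N₁ hN₁).and (hxy ▸ key y hyab hy N₂ hN₂))).exists
  obtain ⟨z₁, hz₁, hz₁S, rfl⟩ := h1 hwK
  obtain ⟨z₂, hz₂, hz₂S, h12⟩ := h2 hwK
  exact disjoint_left.1 hdisj hz₁ (hinj hz₂S hz₁S h12 ▸ hz₂)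

/-! ### Passage to the sphere-valued map and conclusion -/

theorem toSphere_of_analyticAt {f g : ℂ → ℂ} {z : ℂ}
    (hfg : f =ᶠ[𝓝[≠] z] g) (hg : AnalyticAt ℂ g z) : toSphere f z = ((g z : ℂ) : OnePoint ℂ) := by
  rw [toSphere, if_neg, (toMeromorphicNFAt_eventuallyEq_nhds_congr hfg).eq_of_nhds,
    toMeromorphicNFAt_eq_self.2 hg.meromorphicNFAt]
  rw [meromorphicOrderAt_congr hfg]
  exact not_lt.2 hg.meromorphicOrderAt_nonneg

theorem im_eq_zero_of_coe_mem_extendedRealLine {w : ℂ}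
    (hw : (w : OnePoint ℂ) ∈ extendedRealLine) : w.im = 0 := by
  rcases hw with h | ⟨x, hx⟩
  · exact absurd h (OnePoint.coe_ne_infty w)
  · rw [← OnePoint.coe_injective hx, Complex.ofReal_im]

end NevanlinnaFunctions

theorem mainTheorem4 (f : ℂ → ℂ)
    (hf : NevanlinnaFunctions.IsNevanlinna f)
    (hreal : NevanlinnaFunctions.IsReal f)
    (hlog : NevanlinnaFunctions.HasAtLeastLogSingularities f 3)
    (hasymp : ∀ a : OnePoint ℂ, NevanlinnaFunctions.IsAsymptoticValue f a →
      a ∈ NevanlinnaFunctions.extendedRealLine) :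
    {x : ℝ | NevanlinnaFunctions.toSphere f x = ((0 : ℂ) : OnePoint ℂ)}.Subsingleton := by
  open NevanlinnaFunctions in
  obtain ⟨hmer, P, hP⟩ := hf
  have hmer' : MeromorphicOn f univ := fun z _ => hmer z
  set g := toMeromorphicNFOn f univ
  have hg : MeromorphicNFOn g univ := meromorphicNFOn_toMeromorphicNFOn f univ
  have hfg : ∀ z, f =ᶠ[𝓝[≠] z] g := fun z =>
    (hmer'.toMeromorphicNFOn_eq_self_on_nhdsNE (mem_univ z)).symm
  have hloc : ∀ z, (AnalyticAt ℂ g z ∧ deriv g z ≠ 0) ∨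
      (meromorphicOrderAt g z < 0 ∧ AnalyticAt ℂ g⁻¹ z ∧ deriv g⁻¹ z ≠ 0) := fun z => by
    refine deriv_ne_zero_or_deriv_inv_ne_zero (hg (mem_univ z)) ?_
    rw [← meromorphicOrderAt_congr (hfg z).nhdsNE_deriv]
    refine meromorphicOrderAt_deriv_of_schwarzian (h := fun z => 2 * P.eval z) (hmer z)
      (by fun_prop) ?_
    have := disjoint_principal_right.1 (mem_codiscrete.1 hP z)
    rwa [compl_compl] at this
  have hpole : ∀ z, ¬ AnalyticAt ℂ g z → g z = 0 ∧ toSphere f z = OnePoint.infty := fun z hz => by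
    obtain ⟨_, h1, h2⟩ := (meromorphicNFAt_iff_analyticAt_or.1 (hg (mem_univ z))).resolve_left hz
    refine ⟨h2, if_pos ?_⟩
    rwa [meromorphicOrderAt_congr (hfg z)]
  -- Poles cause no exception here, thanks to the value `0` of the normal form.
  have hr : ∀ x : ℝ, (g x).im = 0 := fun x => by
    by_cases hx : AnalyticAt ℂ g x
    · exact im_eq_zero_of_coe_mem_extendedRealLine (toSphere_of_analyticAt (hfg x) hx ▸ hreal x)
    · simp [(hpole x hx).1]
  have hzero : ∀ x : ℝ, toSphere f x = ((0 : ℂ) : OnePoint ℂ) → AnalyticAt ℂ g x ∧ g x = 0 :=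
    fun x hx => by
      have han : AnalyticAt ℂ g x := by
        by_contra h
        exact OnePoint.infty_ne_coe _ ((hpole x h).2.symm.trans hx)
      exact ⟨han, OnePoint.coe_injective ((toSphere_of_analyticAt (hfg x) han).symm.trans hx)⟩
  intro x hx y hy
  obtain ⟨hxa, hx0⟩ := hzero x hx
  obtain ⟨hya, hy0⟩ := hzero y hy
  refine real_injective_of_real_asymptotic hg hloc hr ?_ hxa hya (hx0.trans hy0.symm)
  -- A curve along which `g` tends to a non-real `w` would make `w` an asymptotic value of `f`.
  intro w hw γ hγ hγc han hlim
  refine hw (im_eq_zero_of_coe_mem_extendedRealLine (hasymp w ⟨γ, hγ, hγc, ?_⟩))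
  refine ((OnePoint.continuous_coe.tendsto w).comp hlim).congr' ?_
  filter_upwards [eventually_ge_atTop 0] with t ht
  exact (toSphere_of_analyticAt (hfg _) (han t ht)).symm
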